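/- Let $Q\in\mathbb R^{n\times n}$ be symmetric, $q\in\mathbb R^n$, $A\in\mathbb R^{m\times n}$, $b\in\mathbb R^m$, let $C=\{x\in\mathbb R^n : Ax\ge b\}$ be nonempty and $f(x)=\frac12x^TQx+q^Tx$. For $\alpha\subset\{1,\dots,m\}$ let $$\mathcal F_\alpha=\{x : A_ix=b_i\ (i\in\alpha),\ A_ix>b_i\ (i\notin\alpha)\},\qquad F_\alpha=\{x : A_ix=b_i\ (i\in\alpha),\ A_ix\ge b_i\ (i\notin\alpha)\}$$ be the pseudo-face of $C$ for $\alpha$ and the corresponding face. Let $N_{\mathcal F_\alpha}$ be the normal cone $N_C(x)=\{\xi : \langle\xi,v-x\rangle\le0\ \forall v\in C\}$ at any $x\in\mathcal F_\alpha$ (it does not depend on $x$), and let $0^+F_\alpha$ be the recession cone of $F_\alpha$. Let $C_*$ be the set of KKT points, that is, of the $x$ for which there is $\lambda\in\mathbb R^m$ with $Qx+q-A^T\lambda=0$, $Ax\ge b$, $\lambda\ge0$, $\lambda^T(Ax-b)=0$. Let $\lambda_1(Q)$ and $\lambda_n(Q)$ be the smallest and the largest eigenvalue of $Q$. An InDCA1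 sequence is a sequence $(x^k)_{k\ge0}$ with $x^0\in C$, $x^{-1}=x^0$ and $$x^{k+1}=P_C\Big(\big(1+\tfrac{\gamma}{\eta}\big)x^k-\tfrac{\gamma}{\eta}x^{k-1}-\tfrac1\eta(Qx^k+q)\Big)\qquad(k\ge0),$$ where $P_C$ is the metric projection onto $C$, for some $\eta>0$ with $\eta>\lambda_n(Q)$ and some $\gamma\in\big[0,\frac12(\eta-\lambda_n(Q))\big)$. An InDCA2 sequence is a sequence $(x^k)_{k\ge0}$ with $x^0\in C$, $x^{-1}=x^0$ and $x^{k+1}$ the minimizer over $x\in C$ of $$f(x)+\tfrac{\eta}{2}\|x\|^2-\eta\langle x^k,x\rangle-\gamma\langle x^k-x^{k-1},x\rangle\qquad(k\ge0),$$ for some $\eta>0$ with $\eta>-\lambda_1(Q)$ and some $\gamma\in\big[0,\frac12(\eta+\lambda_1(Q))\big)$. **Theorem.** Suppose that $f$ is bounded below on $C$ and that every unbounded pseudo-face $\mathcal F$ of $C$, with corresponding face $F$, satisfies $$Q\big((0^+F)\setminus\{0\}\big)\cap(-N_{\mathcal F})=\emptyset.\tag{QC}$$ Then for every InDCA1 sequence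 and every InDCA2 sequence $(x^k)$ there is a connected component $C_{i_0}$ of $C_*$ such that $$\lim_{k\to\infty}d(x^k,C_{i_0})=0,$$ where $d(x,S)=\inf_{u\in S}\|x-u\|$. Moreover, $f$ takes the same value at all cluster points of $(x^k)$. -/

import Mathlib

/-- The data of a quadratic program under linear constraints
`min { (1/2) xᵀ Q x + qᵀ x | A x ≥ b }` in `ℝⁿ` with `m` constraints and `Q` symmetric
(not necessarily semidefinite). -/
structure IQP (n m : ℕ) where
  Q : Matrix (Fin n) (Fin n) ℝ
  symm : Q.IsSymm
  q : EuclideanSpace ℝ (Fin n)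
  A : Matrix (Fin m) (Fin n) ℝ
  b : Fin m → ℝ

/-- The normal cone `{ξ | ⟨ξ, v - x⟩ ≤ 0 for all v ∈ Ω}` to `Ω` at a point `x ∈ Ω`. -/
def normalCone {n : ℕ} (Ω : Set (EuclideanSpace ℝ (Fin n))) (x : EuclideanSpace ℝ (Fin n)) :
    Set (EuclideanSpace ℝ (Fin n)) :=
  {ξ | ∀ v ∈ Ω, inner ℝ ξ (v - x) ≤ 0}

/-- The recession cone `0⁺Ω`; it contains `0`. -/
def recessionCone {n : ℕ} (Ω : Set (EuclideanSpace ℝ (Fin n))) :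
    Set (EuclideanSpace ℝ (Fin n)) :=
  {v | ∀ x ∈ Ω, ∀ t : ℝ, 0 ≤ t → x + t • v ∈ Ω}

/-- `p` is the metric projection of `u` onto `Ω`: `p ∈ Ω` and `‖u - p‖ = min_{x ∈ Ω} ‖u - x‖`. -/
def IsMetricProjection {n : ℕ} (Ω : Set (EuclideanSpace ℝ (Fin n)))
    (u p : EuclideanSpace ℝ (Fin n)) : Prop :=
  p ∈ Ω ∧ ∀ x ∈ Ω, ‖u - p‖ ≤ ‖u - x‖

/-- The sequence `k ↦ x^{k-1}` attached to `(x^k)_{k ≥ 0}` under the convention `x^{-1} = x^0`. -/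
def prevIterate {E : Type*} (x : ℕ → E) : ℕ → E
  | 0 => x 0
  | k + 1 => x k

namespace IQP

variable {n m : ℕ}

/-- The linear map `x ↦ Q x` on `ℝⁿ`. -/
noncomputable def mulQ (P : IQP n m) (x : EuclideanSpace ℝ (Fin n)) : EuclideanSpace ℝ (Fin n) :=
  WithLp.toLp 2 (P.Q.mulVec x.ofLp)

/-- The objective function `(1/2) xᵀ Q x + qᵀ x`. -/
noncomputable def objective (P : IQP n m) (x : EuclideanSpace ℝ (Fin n)) : ℝ :=
  1 / 2 * inner ℝ x (P.mulQ x) + inner ℝ P.q x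

/-- The constraint set `C = {x | A x ≥ b}`. -/
def feasible (P : IQP n m) : Set (EuclideanSpace ℝ (Fin n)) :=
  {x | ∀ i, P.b i ≤ P.A.mulVec x.ofLp i}

/-- The pseudo-face of `C` for the index set `α`:
the constraints in `α` are equalities, all the others are strict. -/
def pseudoFace (P : IQP n m) (α : Finset (Fin m)) : Set (EuclideanSpace ℝ (Fin n)) :=
  {x | (∀ i ∈ α, P.A.mulVec x.ofLp i = P.b i) ∧ ∀ i ∉ α, P.b i < P.A.mulVec x.ofLp i}

/-- The face of `C` that corresponds to the pseudo-face for `α`. -/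
def face (P : IQP n m) (α : Finset (Fin m)) : Set (EuclideanSpace ℝ (Fin n)) :=
  {x | (∀ i ∈ α, P.A.mulVec x.ofLp i = P.b i) ∧ ∀ i ∉ α, P.b i ≤ P.A.mulVec x.ofLp i}

/-- The normal cone of a pseudo-face: the normal cone to `C` at any of its points
(it is the same at all of them, see `pseudoFaceNormalCone_eq`). -/
def pseudoFaceNormalCone (P : IQP n m) (α : Finset (Fin m)) : Set (EuclideanSpace ℝ (Fin n)) :=
  {ξ | ∃ x ∈ P.pseudoFace α, ξ ∈ normalCone P.feasible x}

theorem normalCone_subset_of_mem_pseudoFace (P : IQP n m) (α : Finset (Fin m))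
    {x y : EuclideanSpace ℝ (Fin n)} (hx : x ∈ P.pseudoFace α) (hy : y ∈ P.pseudoFace α) :
    normalCone P.feasible x ⊆ normalCone P.feasible y := by
  intro ξ hξ v hv
  have key : ∀ᶠ t : ℝ in nhdsWithin 0 (Set.Ioi 0), x + t • (v - y) ∈ P.feasible := by
    have hform : ∀ (t : ℝ) (i : Fin m), P.A.mulVec (x + t • (v - y)).ofLp i
        = P.A.mulVec x.ofLp i + t * (P.A.mulVec v.ofLp i - P.A.mulVec y.ofLp i) := by
      intro t i
      simp [Matrix.mulVec_add, Matrix.mulVec_smul, Matrix.mulVec_sub]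
    refine Filter.eventually_all.2 fun i => ?_
    by_cases hi : i ∈ α
    · filter_upwards [self_mem_nhdsWithin] with t ht
      rw [hform, hx.1 i hi, hy.1 i hi]
      have := mul_nonneg (le_of_lt (Set.mem_Ioi.1 ht)) (sub_nonneg.2 (hv i))
      linarith
    · have hc : Filter.Tendsto (fun t : ℝ => P.A.mulVec x.ofLp i
          + t * (P.A.mulVec v.ofLp i - P.A.mulVec y.ofLp i)) (nhdsWithin 0 (Set.Ioi 0))
          (nhds (P.A.mulVec x.ofLp i)) := by
        have h : Continuous (fun t : ℝ => P.A.mulVec x.ofLp i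
          + t * (P.A.mulVec v.ofLp i - P.A.mulVec y.ofLp i)) := by fun_prop
        simpa using (h.tendsto 0).mono_left nhdsWithin_le_nhds
      filter_upwards [hc.eventually_const_lt (hx.2 i hi)] with t ht
      rw [hform]
      exact ht.le
  obtain ⟨t, ht, ht0⟩ := (key.and self_mem_nhdsWithin).exists
  have h := hξ _ ht
  rw [add_sub_cancel_left, inner_smul_right] at h
  exact nonpos_of_mul_nonpos_right h ht0

theorem pseudoFaceNormalCone_eq (P : IQP n m) (α : Finset (Fin m))
    {x : EuclideanSpace ℝ (Fin n)} (hx : x ∈ P.pseudoFace α) :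
    P.pseudoFaceNormalCone α = normalCone P.feasible x :=
  Set.Subset.antisymm
    (fun _ ⟨_, hy, hξ⟩ => P.normalCone_subset_of_mem_pseudoFace α hy hx hξ)
    (fun _ hξ => ⟨x, hx, hξ⟩)

/-- The qualification condition (QC):
`Q((0⁺F) \ {0}) ∩ (-N_𝓕) = ∅` for every unbounded pseudo-face `𝓕` with face `F`. -/
def QualificationCondition (P : IQP n m) : Prop :=
  ∀ α : Finset (Fin m), ¬ Bornology.IsBounded (P.pseudoFace α) →
    (P.mulQ '' (recessionCone (P.face α) \ {0})) ∩ {ξ | -ξ ∈ P.pseudoFaceNormalCone α} = ∅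

/-- The set `C_*` of Karush-Kuhn-Tucker points. -/
def kktSet (P : IQP n m) : Set (EuclideanSpace ℝ (Fin n)) :=
  {x | ∃ l : Fin m → ℝ,
    P.mulQ x + P.q - WithLp.toLp 2 (P.A.transpose.mulVec l) = 0 ∧
    (∀ i, P.b i ≤ P.A.mulVec x.ofLp i) ∧ (∀ i, 0 ≤ l i) ∧
    l ⬝ᵥ (P.A.mulVec x.ofLp - P.b) = 0}

/-- The largest eigenvalue `λ_n(Q)` (the spectrum is finite, and nonempty if `n ≥ 1`). -/
noncomputable def maxEigenvalue (P : IQP n m) : ℝ := sSup (spectrum ℝ P.Q)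

/-- The smallest eigenvalue `λ_1(Q)` (the spectrum is finite, and nonempty if `n ≥ 1`). -/
noncomputable def minEigenvalue (P : IQP n m) : ℝ := sInf (spectrum ℝ P.Q)

/-- `x` is an iteration sequence of the inertial projection DC algorithm InDCA1 with
decomposition parameter `η` and inertial parameter `γ`, where `ρ = η - λ_n(Q)` and `Tol = 0`.
When the test `x^{k+1} = x^k` and `γ (x^k - x^{k-1}) = 0` stops the algorithm, the recursion
just repeats `x^k` for ever, so a run that stops is represented by its constant continuation. -/
structure IsInDCA1Sequence (P : IQP n m) (η γ : ℝ) (x : ℕ → EuclideanSpace ℝ (Fin n)) :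
    Prop where
  eta_pos : 0 < η
  eta_gt : P.maxEigenvalue < η
  gamma_nonneg : 0 ≤ γ
  gamma_lt : γ < 2⁻¹ * (η - P.maxEigenvalue)
  init_mem : x 0 ∈ P.feasible
  step : ∀ k, IsMetricProjection P.feasible
    ((1 + γ / η) • x k - (γ / η) • prevIterate x k - (1 / η) • (P.mulQ (x k) + P.q)) (x (k + 1))

/-- The objective of the proximal subproblem of InDCA2, for `y = x^k` and `z = x^{k-1}`. -/
noncomputable def proximalObjective (P : IQP n m) (η γ : ℝ) (y z : EuclideanSpace ℝ (Fin n))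
    (x : EuclideanSpace ℝ (Fin n)) : ℝ :=
  P.objective x + η / 2 * ‖x‖ ^ 2 - η * inner ℝ y x - γ * inner ℝ (y - z) x

/-- `x` is an iteration sequence of the inertial proximal DC algorithm InDCA2 with
decomposition parameter `η` and inertial parameter `γ`, where `ρ = η + λ_1(Q)` and `Tol = 0`
(a run that stops is represented by its constant continuation, as for InDCA1). -/
structure IsInDCA2Sequence (P : IQP n m) (η γ : ℝ) (x : ℕ → EuclideanSpace ℝ (Fin n)) :
    Prop where
  eta_pos : 0 < η
  eta_gt : -P.minEigenvalue < η
  gamma_nonneg : 0 ≤ γ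
  gamma_lt : γ < 2⁻¹ * (η + P.minEigenvalue)
  init_mem : x 0 ∈ P.feasible
  step_mem : ∀ k, x (k + 1) ∈ P.feasible
  step_min : ∀ k, IsMinOn (P.proximalObjective η γ (x k) (prevIterate x k)) P.feasible (x (k + 1))

end IQP

/-! Write `d = x^{k+1} - x^k`. Testing the optimality condition of either subproblem at `x^k` shows
that the energy `f(x^k) + γ/2 ‖x^k - x^{k-1}‖²` drops by at least `σ‖d‖²` with `σ > 0`. As `f` is
bounded below on `C`, the energy converges, so the steps tend to `0` and `f(x^k)` converges. The
same condition reads `r_k - ∇f(x^{k+1}) ∈ N_C(x^{k+1})` with `r_k → 0`. `IsInertialDescentSequence`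
records these two facts, and nothing else about the algorithms is used.

(QC) makes the sequence bounded (`QualificationCondition.isBounded_range`): otherwise, along an
ultrafilter, the iterates go to infinity within one pseudo-face, with a limit direction `v ≠ 0` in
`0⁺F`. Dividing the optimality condition by the norm leaves `-Qv ∈ N_𝓕`, which (QC) forbids.

Cluster points are then KKT by passage to the limit and Farkas' lemma. They form a connected set
because the steps vanish (Ostrowski), so a single component of `C_*` contains them all, and a
bounded sequence approaches its cluster set. -/

open Filter Topology

/-! ### Farkas' lemma -/

/-- **Farkas' lemma** for finitely many linear functionals on a real vector space: a functional that
is nonnegative wherever all the `f i` are is a conical combination of them. -/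
theorem Module.Dual.exists_nonneg_combination_of_nonneg {ι V : Type*} [AddCommGroup V] [Module ℝ V]
    (s : Finset ι) (f : ι → V →ₗ[ℝ] ℝ) (g : V →ₗ[ℝ] ℝ)
    (h : ∀ v, (∀ i ∈ s, 0 ≤ f i v) → 0 ≤ g v) :
    ∃ c : ι → ℝ, (∀ i, 0 ≤ c i) ∧ g = ∑ i ∈ s, c i • f i := by
  classical
  induction s using Finset.induction_on generalizing f g with
  | empty =>
    refine ⟨0, fun _ => le_rfl, ?_⟩
    ext v
    have h₁ := h v (by simp)
    have h₂ := h (-v) (by simp)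
    rw [map_neg] at h₂
    simp only [Finset.sum_empty, LinearMap.zero_apply]
    linarith
  | insert j s hj ih =>
    by_cases hs : ∀ v, (∀ i ∈ s, 0 ≤ f i v) → 0 ≤ g v
    · obtain ⟨c, hc, hg⟩ := ih f g hs
      refine ⟨Function.update c j 0, fun i => ?_, ?_⟩
      · by_cases hij : i = j
        · simp [hij]
        · simpa [hij] using hc i
      · rw [Finset.sum_insert hj, Function.update_self, zero_smul, zero_add, hg]
        refine Finset.sum_congr rfl fun i hi => ?_
        rw [Function.update_of_ne (ne_of_mem_of_not_mem hi hj)]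
    · push Not at hs
      obtain ⟨u₀, hu₀, hgu₀⟩ := hs
      have hfj : f j u₀ < 0 := by
        by_contra hcon
        refine absurd (h u₀ fun i hi => ?_) (not_le.2 hgu₀)
        rcases Finset.mem_insert.1 hi with rfl | hi
        · exact not_lt.1 hcon
        · exact hu₀ i hi
      obtain ⟨u, hu, hgu, hju⟩ : ∃ u, (∀ i ∈ s, 0 ≤ f i u) ∧ g u < 0 ∧ f j u = -1 := by
        have hpos : 0 < -(f j u₀)⁻¹ := neg_pos.2 (inv_lt_zero.2 hfj)
        refine ⟨(-(f j u₀)⁻¹) • u₀, fun i hi => ?_, ?_, ?_⟩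
        · rw [map_smul]
          exact mul_nonneg hpos.le (hu₀ i hi)
        · rw [map_smul]
          exact mul_neg_of_pos_of_neg hpos hgu₀
        · rw [map_smul, smul_eq_mul, neg_mul, inv_mul_cancel₀ hfj.ne]
      -- Induct on the functionals composed with `v ↦ v + f j v • u`, the projection onto `ker (f
      -- j)` along `u`.
      obtain ⟨c, hc, hg⟩ := ih (fun i => f i + f i u • f j) (g + g u • f j) (by
        intro v hv
        have := h (v + f j v • u) fun i hi => by
          rcases Finset.mem_insert.1 hi with rfl | hi
          · simp [hju]
          · simpa [mul_comm] using hv i hi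
        simpa [mul_comm] using this)
      -- The coefficient of `f j` is read off from `hg`; it is nonnegative because `f i u ≥ 0` and
      -- `g u < 0`.
      refine ⟨Function.update c j (∑ i ∈ s, c i * f i u - g u), fun i => ?_, ?_⟩
      · by_cases hij : i = j
        · subst hij
          simpa using hgu.le.trans
            (Finset.sum_nonneg fun i hi => mul_nonneg (hc i) (hu i hi))
        · simpa [hij] using hc i
      · have hsum : ∑ i ∈ s, Function.update c j (∑ i ∈ s, c i * f i u - g u) i • f i
            = ∑ i ∈ s, c i • f i :=
          Finset.sum_congr rfl fun i hi => by
            rw [Function.update_of_ne (ne_of_mem_of_not_mem hi hj)]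
        rw [Finset.sum_insert hj, hsum, Function.update_self]
        ext v
        have hv := LinearMap.congr_fun hg v
        simp only [LinearMap.add_apply, LinearMap.smul_apply, LinearMap.sum_apply, smul_eq_mul,
          mul_add, Finset.sum_add_distrib, ← mul_assoc, ← Finset.sum_mul] at hv ⊢
        linarith

/-! ### Cluster points of bounded sequences -/

/-- A bounded sequence in a proper space is eventually in any open set that contains all of its
cluster points. -/
theorem eventually_mem_of_mapClusterPt_subset {E : Type*} [PseudoMetricSpace E] [ProperSpace E]
    {x : ℕ → E} (hb : Bornology.IsBounded (Set.range x)) {U : Set E} (hU : IsOpen U)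
    (h : ∀ y, MapClusterPt y atTop x → y ∈ U) : ∀ᶠ k in atTop, x k ∈ U := by
  by_contra hcon
  have hf : ∃ᶠ k in atTop, x k ∈ closure (Set.range x) \ U :=
    (not_eventually.1 hcon).mono fun k hk => ⟨subset_closure ⟨k, rfl⟩, hk⟩
  obtain ⟨y, hy, hyx⟩ := (hb.isCompact_closure.diff hU).exists_mapClusterPt_of_frequently hf
  exact hy.2 (h y hyx)

/-- The set of cluster points of a bounded sequence whose steps tend to `0` is preconnected
(**Ostrowski**). -/
theorem isPreconnected_setOf_mapClusterPt {E : Type*} [MetricSpace E] [ProperSpace E]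
    {x : ℕ → E} (hb : Bornology.IsBounded (Set.range x))
    (hd : Tendsto (fun k => dist (x (k + 1)) (x k)) atTop (𝓝 0)) :
    IsPreconnected {y | MapClusterPt y atTop x} := by
  set S := {y | MapClusterPt y atTop x} with hS
  have hSc : IsClosed S := isClosed_setOfPred_clusterPt
  have hScomp : IsCompact S := by
    refine hb.isCompact_closure.of_isClosed_subset hSc fun y hy => ?_
    exact mem_closure_iff_clusterPt.2 (ClusterPt.mono hy (by simp))
  refine isPreconnected_closed_iff.2 fun t t' ht ht' hsub hA hB => ?_
  by_contra hne
  have hdisj : Disjoint (S ∩ t) (S ∩ t') := by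
    rw [Set.disjoint_left]
    exact fun y hy hy' => hne ⟨y, hy.1, hy.2, hy'.2⟩
  obtain ⟨δ, hδ, hthick⟩ := hdisj.exists_thickenings (hScomp.inter_right ht) (hSc.inter ht')
  -- With radius `δ / 2`, a step shorter than `δ / 2` from `U` stays in the `δ`-thickening of `S ∩
  -- t`, so it cannot reach `V`.
  set U := Metric.thickening (δ / 2) (S ∩ t)
  set V := Metric.thickening (δ / 2) (S ∩ t')
  have hVsub : V ⊆ Metric.thickening δ (S ∩ t') := Metric.thickening_mono (by linarith) _
  have hUV : ∀ᶠ k in atTop, x k ∈ U ∪ V := by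
    refine eventually_mem_of_mapClusterPt_subset hb
      (Metric.isOpen_thickening.union Metric.isOpen_thickening) fun y hy => ?_
    rcases hsub hy with hyt | hyt
    · exact Or.inl (Metric.self_subset_thickening (by linarith) _ ⟨hy, hyt⟩)
    · exact Or.inr (Metric.self_subset_thickening (by linarith) _ ⟨hy, hyt⟩)
  have hstep : ∀ᶠ k in atTop, dist (x (k + 1)) (x k) < δ / 2 :=
    hd.eventually_lt_const (by linarith)
  obtain ⟨N, hN⟩ := eventually_atTop.1 (hUV.and hstep)
  have hfreq : ∀ {T : Set E}, (S ∩ T).Nonempty →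
      ∃ᶠ k in atTop, x k ∈ Metric.thickening (δ / 2) (S ∩ T) := fun {T} ⟨y, hy⟩ =>
    (mapClusterPt_iff_frequently.1 hy.1) _ (Metric.isOpen_thickening.mem_nhds
      (Metric.self_subset_thickening (by linarith) _ hy))
  obtain ⟨k₀, hk₀, hk₀U⟩ := (frequently_atTop.1 (hfreq hA)) N
  have hstay : ∀ k, k₀ ≤ k → x k ∈ U := by
    intro k hk
    induction k, hk using Nat.le_induction with
    | base => exact hk₀U
    | succ k hk ihk =>
      refine (hN (k + 1) (by omega)).1.resolve_right fun hkV => ?_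
      obtain ⟨a, ha, hxa⟩ := Metric.mem_thickening_iff.1 ihk
      refine Set.disjoint_left.1 hthick (Metric.mem_thickening_iff.2 ⟨a, ha, ?_⟩) (hVsub hkV)
      have := dist_triangle (x (k + 1)) (x k) a
      have := (hN k (by omega)).2
      linarith
  obtain ⟨k₁, hk₁, hk₁V⟩ := (frequently_atTop.1 (hfreq hB)) k₀
  exact Set.disjoint_left.1 hthick
    (Metric.thickening_mono (by linarith) _ (hstay k₁ hk₁)) (hVsub hk₁V)

/-! ### The quadratic form, the polyhedron and KKT points -/

namespace IQP

variable {n m : ℕ}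

theorem mulQ_eq_toEuclideanCLM (P : IQP n m) (x : EuclideanSpace ℝ (Fin n)) :
    P.mulQ x = Matrix.toEuclideanCLM (𝕜 := ℝ) P.Q x := rfl

theorem inner_mulQ_comm (P : IQP n m) (x y : EuclideanSpace ℝ (Fin n)) :
    inner ℝ (P.mulQ x) y = inner ℝ x (P.mulQ y) :=
  Matrix.isSymmetric_toEuclideanLin_iff.2 (by simpa [Matrix.IsHermitian] using! P.symm) x y

theorem inner_mulQ_self (P : IQP n m) (x : EuclideanSpace ℝ (Fin n)) :
    inner ℝ x (P.mulQ x) = x.ofLp ⬝ᵥ P.Q.mulVec x.ofLp := by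
  rw [EuclideanSpace.inner_eq_star_dotProduct, dotProduct_comm]
  rfl

theorem posSemidef_of_spectrum_nonneg {M : Matrix (Fin n) (Fin n) ℝ} (hM : M.IsSymm)
    (h : ∀ r ∈ spectrum ℝ M, 0 ≤ r) : M.PosSemidef := by
  have hH : M.IsHermitian := by simpa [Matrix.IsHermitian] using! hM
  exact hH.posSemidef_iff_eigenvalues_nonneg.2 fun i => h _ (hH.eigenvalues_mem_spectrum_real i)

/-- The spectrum of `λ_n I - Q` is `λ_n - spec Q ≥ 0`, so this matrix is positive semidefinite. -/
theorem inner_mulQ_self_le (P : IQP n m) (x : EuclideanSpace ℝ (Fin n)) :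
    inner ℝ x (P.mulQ x) ≤ P.maxEigenvalue * ‖x‖ ^ 2 := by
  have hpsd : (algebraMap ℝ (Matrix (Fin n) (Fin n) ℝ) P.maxEigenvalue - P.Q).PosSemidef := by
    refine posSemidef_of_spectrum_nonneg ?_ fun r hr => ?_
    · simp [Matrix.IsSymm, Matrix.algebraMap_eq_diagonal, P.symm.eq]
    · rw [← spectrum.singleton_sub_eq, Set.singleton_sub] at hr
      obtain ⟨s, hs, rfl⟩ := hr
      exact sub_nonneg.2 (le_csSup (Matrix.finite_real_spectrum).bddAbove hs)
  have := hpsd.dotProduct_mulVec_nonneg x.ofLp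
  rw [inner_mulQ_self, EuclideanSpace.real_norm_sq_eq]
  simp [Matrix.sub_mulVec, Matrix.algebraMap_eq_diagonal, dotProduct, Matrix.mulVec_diagonal,
    Finset.mul_sum] at this ⊢
  rw [← sub_nonneg, ← Finset.sum_sub_distrib]
  exact this.trans_eq (Finset.sum_congr rfl fun i _ => by ring)

theorem le_inner_mulQ_self (P : IQP n m) (x : EuclideanSpace ℝ (Fin n)) :
    P.minEigenvalue * ‖x‖ ^ 2 ≤ inner ℝ x (P.mulQ x) := by
  have hpsd : (P.Q - algebraMap ℝ (Matrix (Fin n) (Fin n) ℝ) P.minEigenvalue).PosSemidef := by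
    refine posSemidef_of_spectrum_nonneg ?_ fun r hr => ?_
    · simp [Matrix.IsSymm, Matrix.algebraMap_eq_diagonal, P.symm.eq]
    · rw [← spectrum.sub_singleton_eq, Set.sub_singleton] at hr
      obtain ⟨s, hs, rfl⟩ := hr
      exact sub_nonneg.2 (csInf_le (Matrix.finite_real_spectrum).bddBelow hs)
  have := hpsd.dotProduct_mulVec_nonneg x.ofLp
  rw [inner_mulQ_self, EuclideanSpace.real_norm_sq_eq]
  simp [Matrix.sub_mulVec, Matrix.algebraMap_eq_diagonal, dotProduct, Matrix.mulVec_diagonal,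
    Finset.mul_sum] at this ⊢
  rw [← sub_nonneg, ← Finset.sum_sub_distrib]
  exact this.trans_eq (Finset.sum_congr rfl fun i _ => by ring)

theorem convex_feasible (P : IQP n m) : Convex ℝ P.feasible := by
  intro x hx y hy a b ha hb hab i
  have h₁ := mul_le_mul_of_nonneg_left (hx i) ha
  have h₂ := mul_le_mul_of_nonneg_left (hy i) hb
  have h₃ : P.A.mulVec (a • x + b • y).ofLp i
      = a * P.A.mulVec x.ofLp i + b * P.A.mulVec y.ofLp i := by
    simp [Matrix.mulVec_add, Matrix.mulVec_smul]
  have h₄ : a * P.b i + b * P.b i = P.b i := by rw [← add_mul, hab, one_mul]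
  linarith

theorem isClosed_feasible (P : IQP n m) : IsClosed P.feasible := by
  have : P.feasible = ⋂ i, {x | P.b i ≤ P.A.mulVec x.ofLp i} := by ext; simp [feasible]
  rw [this]
  refine isClosed_iInter fun i => isClosed_le continuous_const ?_
  simp only [Matrix.mulVec, dotProduct]
  fun_prop

theorem exists_mem_pseudoFace (P : IQP n m) {x : EuclideanSpace ℝ (Fin n)}
    (hx : x ∈ P.feasible) : ∃ α, x ∈ P.pseudoFace α := by
  classical
  refine ⟨Finset.univ.filter fun i => P.A.mulVec x.ofLp i = P.b i,
    fun i hi => (Finset.mem_filter.1 hi).2, fun i hi => ?_⟩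
  exact lt_of_le_of_ne (hx i) fun h => hi (Finset.mem_filter.2 ⟨Finset.mem_univ i, h.symm⟩)

/-- A feasible point is a KKT point if the negative gradient lies in the normal cone. -/
theorem mem_kktSet_of_neg_gradient_mem_normalCone (P : IQP n m) {x : EuclideanSpace ℝ (Fin n)}
    (hx : x ∈ P.feasible) (h : -(P.mulQ x + P.q) ∈ normalCone P.feasible x) : x ∈ P.kktSet := by
  classical
  let f : Fin m → EuclideanSpace ℝ (Fin n) →ₗ[ℝ] ℝ := fun i =>
    innerₗ (EuclideanSpace ℝ (Fin n)) (WithLp.toLp 2 (P.A i))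
  have hf : ∀ i v, f i v = P.A.mulVec v.ofLp i := fun i v => by
    simp [f, EuclideanSpace.inner_eq_star_dotProduct, Matrix.mulVec, dotProduct_comm]
  obtain ⟨α, hα⟩ := P.exists_mem_pseudoFace hx
  obtain ⟨c, hc, hg⟩ := Module.Dual.exists_nonneg_combination_of_nonneg α f
    (innerₗ (EuclideanSpace ℝ (Fin n)) (P.mulQ x + P.q)) (by
      intro v hv
      -- Only active constraints can block a short move, so `v` is a feasible direction.
      have key : ∀ᶠ t : ℝ in 𝓝[>] 0, x + t • v ∈ P.feasible := by
        have hform : ∀ (t : ℝ) (i : Fin m), P.A.mulVec (x + t • v).ofLp i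
            = P.A.mulVec x.ofLp i + t * P.A.mulVec v.ofLp i := by
          intro t i
          simp [Matrix.mulVec_add, Matrix.mulVec_smul]
        refine eventually_all.2 fun i => ?_
        by_cases hi : i ∈ α
        · filter_upwards [self_mem_nhdsWithin] with t ht
          rw [hform, hα.1 i hi, ← hf]
          exact le_add_of_nonneg_right (mul_nonneg (le_of_lt ht) (hv i hi))
        · have hcont : Continuous fun t : ℝ => P.A.mulVec x.ofLp i + t * P.A.mulVec v.ofLp i := by
            fun_prop
          have hlim := (hcont.tendsto 0).mono_left (nhdsWithin_le_nhds (s := Set.Ioi 0))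
          simp only [zero_mul, add_zero] at hlim
          filter_upwards [hlim.eventually_const_lt (hα.2 i hi)] with t ht
          rw [hform]
          exact ht.le
      obtain ⟨t, ht, ht0⟩ := (key.and self_mem_nhdsWithin).exists
      have h' := h _ ht
      rw [add_sub_cancel_left, inner_smul_right, inner_neg_left] at h'
      rw [innerₗ_apply_apply]
      exact neg_nonpos.1 (nonpos_of_mul_nonpos_right h' ht0))
  -- Multipliers vanish off the active set, which gives complementary slackness.
  refine ⟨fun i => if i ∈ α then c i else 0, ?_, hx, fun i => ?_, ?_⟩
  · refine ext_inner_right ℝ fun v => ?_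
    have hv := LinearMap.congr_fun hg v
    rw [inner_sub_left, inner_zero_left, sub_eq_zero]
    rw [innerₗ_apply_apply] at hv
    rw [hv, EuclideanSpace.inner_eq_star_dotProduct, dotProduct_comm]
    simp only [LinearMap.sum_apply, LinearMap.smul_apply, hf, smul_eq_mul, star_trivial]
    rw [Matrix.mulVec_transpose, ← Matrix.dotProduct_mulVec]
    simp [dotProduct, Finset.sum_ite_mem]
  · show 0 ≤ if i ∈ α then c i else 0
    split_ifs
    exacts [hc i, le_rfl]
  · refine Finset.sum_eq_zero fun i _ => ?_
    by_cases hi : i ∈ α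
    · simp [hα.1 i hi]
    · simp [hi]

theorem objective_add (P : IQP n m) (x d : EuclideanSpace ℝ (Fin n)) :
    P.objective (x + d)
      = P.objective x + inner ℝ (P.mulQ x + P.q) d + 1 / 2 * inner ℝ d (P.mulQ d) := by
  have h : P.mulQ (x + d) = P.mulQ x + P.mulQ d := by simp [mulQ_eq_toEuclideanCLM]
  simp only [objective, h, inner_add_left, inner_add_right, P.inner_mulQ_comm x d]
  rw [← P.inner_mulQ_comm d x, real_inner_comm x (P.mulQ d), ← P.inner_mulQ_comm x d]
  ring

theorem continuous_mulQ (P : IQP n m) : Continuous P.mulQ :=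
  (Matrix.toEuclideanCLM (𝕜 := ℝ) P.Q).continuous

theorem continuous_objective (P : IQP n m) : Continuous P.objective := by
  have := P.continuous_mulQ
  unfold objective
  fun_prop

theorem sub_mem_normalCone_of_isMetricProjection {Ω : Set (EuclideanSpace ℝ (Fin n))}
    (hΩ : Convex ℝ Ω) {u p : EuclideanSpace ℝ (Fin n)} (h : IsMetricProjection Ω u p) :
    u - p ∈ normalCone Ω p := by
  refine (norm_eq_iInf_iff_real_inner_le_zero hΩ h.1).1 ?_
  have : Nonempty Ω := ⟨⟨p, h.1⟩⟩
  refine le_antisymm (le_ciInf fun w => h.2 w w.2) (ciInf_le ?_ (⟨p, h.1⟩ : Ω))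
  exact ⟨0, by rintro _ ⟨w, rfl⟩; exact norm_nonneg _⟩

/-! ### Both algorithms as inertial descent sequences -/

/-- The properties shared by the iteration sequences of both algorithms: an approximate descent
property, and an optimality condition with a residual that is controlled by the last two steps. -/
structure IsInertialDescentSequence (P : IQP n m) (γ σ : ℝ)
    (L : EuclideanSpace ℝ (Fin n) →L[ℝ] EuclideanSpace ℝ (Fin n))
    (x : ℕ → EuclideanSpace ℝ (Fin n)) : Prop where
  gamma_nonneg : 0 ≤ γ
  sigma_pos : 0 < σ
  mem : ∀ k, x k ∈ P.feasible
  descent : ∀ k, P.objective (x (k + 1)) + (γ / 2 + σ) * ‖x (k + 1) - x k‖ ^ 2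
    ≤ P.objective (x k) + γ / 2 * ‖x k - prevIterate x k‖ ^ 2
  normal : ∀ k, L (x (k + 1) - x k) + γ • (x k - prevIterate x k) - (P.mulQ (x (k + 1)) + P.q)
    ∈ normalCone P.feasible (x (k + 1))

/-- Expand `γ‖x - y‖² ≥ 0`. This splits the inertial cross term between the old and the new energy.
-/
theorem mul_inner_le_half_mul_sq_add (γ : ℝ) (hγ : 0 ≤ γ) (x y : EuclideanSpace ℝ (Fin n)) :
    γ * inner ℝ x y ≤ γ / 2 * ‖x‖ ^ 2 + γ / 2 * ‖y‖ ^ 2 := by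
  have h := norm_sub_sq_real x y
  have := mul_nonneg hγ (sq_nonneg ‖x - y‖)
  rw [h] at this
  linarith

theorem IsInDCA1Sequence.isInertialDescentSequence {P : IQP n m} {η γ : ℝ}
    {x : ℕ → EuclideanSpace ℝ (Fin n)} (h : P.IsInDCA1Sequence η γ x) :
    P.IsInertialDescentSequence γ (η - P.maxEigenvalue / 2 - γ)
      (Matrix.toEuclideanCLM (𝕜 := ℝ) P.Q - η • ContinuousLinearMap.id ℝ _) x := by
  have hη := h.eta_pos
  have hmem : ∀ k, x k ∈ P.feasible
    | 0 => h.init_mem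
    | k + 1 => (h.step k).1
  have hvi : ∀ k, γ • (x k - prevIterate x k) - η • (x (k + 1) - x k) - (P.mulQ (x k) + P.q)
      ∈ normalCone P.feasible (x (k + 1)) := by
    intro k v hv
    have h₁ := sub_mem_normalCone_of_isMetricProjection P.convex_feasible (h.step k) v hv
    have h₂ := mul_nonpos_of_nonneg_of_nonpos hη.le h₁
    rw [← real_inner_smul_left] at h₂
    have heq : γ • (x k - prevIterate x k) - η • (x (k + 1) - x k) - (P.mulQ (x k) + P.q)
        = η • ((1 + γ / η) • x k - (γ / η) • prevIterate x k - (1 / η) • (P.mulQ (x k) + P.q)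
          - x (k + 1)) := by
      match_scalars <;> field_simp
      ring
    rwa [heq]
  -- The bound on `γ` gives `σ > η / 2`, so positivity of `η` suffices.
  refine ⟨h.gamma_nonneg, by linarith [h.gamma_lt], hmem, fun k => ?_, fun k => ?_⟩
  · have h₁ := hvi k (x k) (hmem k)
    have h₂ := P.objective_add (x k) (x (k + 1) - x k)
    rw [add_sub_cancel] at h₂
    have h₃ := P.inner_mulQ_self_le (x (k + 1) - x k)
    have h₄ := mul_inner_le_half_mul_sq_add γ h.gamma_nonneg (x k - prevIterate x k)
      (x (k + 1) - x k)
    rw [← neg_sub (x (k + 1)) (x k), inner_neg_right, inner_sub_left, inner_sub_left,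
      real_inner_smul_left, real_inner_smul_left, real_inner_self_eq_norm_sq] at h₁
    linarith
  · convert hvi k using 1
    -- The projection step uses the gradient at `x k`; moving it to `x (k + 1)` costs `Q d`, the `Q`
    -- part of `L`.
    have : P.mulQ (x (k + 1)) = P.mulQ (x k) + P.mulQ (x (k + 1) - x k) := by
      simp [mulQ_eq_toEuclideanCLM]
    rw [this]
    simp only [sub_apply, ← mulQ_eq_toEuclideanCLM,
      smul_apply, ContinuousLinearMap.id_apply]
    abel

/-- Divide by `t` and let `t → 0⁺`; this extracts the first-order condition from minimality along a
segment. -/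
theorem nonneg_of_forall_small_quadratic_nonneg {a b : ℝ}
    (h : ∀ t : ℝ, 0 < t → t ≤ 1 → 0 ≤ t * a + t ^ 2 * b) : 0 ≤ a := by
  have hlim : Tendsto (fun t : ℝ => a + t * b) (𝓝[>] 0) (𝓝 a) := by
    have hc : Continuous fun t : ℝ => a + t * b := by fun_prop
    simpa using (hc.tendsto 0).mono_left (nhdsWithin_le_nhds (s := Set.Ioi 0))
  refine ge_of_tendsto hlim ?_
  filter_upwards [Ioc_mem_nhdsGT (zero_lt_one' ℝ)] with t ht
  have := h t ht.1 ht.2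
  exact nonneg_of_mul_nonneg_right (by linarith : 0 ≤ t * (a + t * b)) ht.1

theorem proximalObjective_add (P : IQP n m) (η γ : ℝ) (y z p d : EuclideanSpace ℝ (Fin n)) :
    P.proximalObjective η γ y z (p + d) = P.proximalObjective η γ y z p
      + inner ℝ (P.mulQ p + P.q + η • (p - y) - γ • (y - z)) d
      + (1 / 2 * inner ℝ d (P.mulQ d) + η / 2 * ‖d‖ ^ 2) := by
  simp only [proximalObjective, objective_add, norm_add_sq_real, inner_add_right,
    inner_sub_left (_ + _ + _), inner_add_left (P.mulQ p + P.q) (η • (p - y)),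
    real_inner_smul_left, inner_sub_left p y]
  ring

theorem IsInDCA2Sequence.isInertialDescentSequence {P : IQP n m} {η γ : ℝ}
    {x : ℕ → EuclideanSpace ℝ (Fin n)} (h : P.IsInDCA2Sequence η γ x) :
    P.IsInertialDescentSequence γ (η + P.minEigenvalue / 2 - γ)
      (-η • ContinuousLinearMap.id ℝ _) x := by
  have hη := h.eta_pos
  have hmem : ∀ k, x k ∈ P.feasible
    | 0 => h.init_mem
    | k + 1 => h.step_mem k
  have hvi : ∀ k, γ • (x k - prevIterate x k) - η • (x (k + 1) - x k) - (P.mulQ (x (k + 1)) + P.q)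
      ∈ normalCone P.feasible (x (k + 1)) := by
    intro k v hv
    have key : 0 ≤ inner ℝ (P.mulQ (x (k + 1)) + P.q + η • (x (k + 1) - x k)
        - γ • (x k - prevIterate x k)) (v - x (k + 1)) := by
      refine nonneg_of_forall_small_quadratic_nonneg
        (b := 1 / 2 * inner ℝ (v - x (k + 1)) (P.mulQ (v - x (k + 1)))
          + η / 2 * ‖v - x (k + 1)‖ ^ 2) fun t ht0 ht1 => ?_
      have h₁ := isMinOn_iff.1 (h.step_min k) _
        (P.convex_feasible.add_smul_sub_mem (hmem (k + 1)) hv ⟨ht0.le, ht1⟩)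
      have h₂ : P.mulQ (t • (v - x (k + 1))) = t • P.mulQ (v - x (k + 1)) := by
        simp [mulQ_eq_toEuclideanCLM]
      rw [proximalObjective_add, h₂, norm_smul, mul_pow, Real.norm_eq_abs, sq_abs,
        real_inner_smul_left, real_inner_smul_right, real_inner_smul_right] at h₁
      linarith
    rw [← neg_nonneg, ← inner_neg_left]
    convert key using 2
    abel
  refine ⟨h.gamma_nonneg, by linarith [h.gamma_lt], hmem, fun k => ?_, fun k => ?_⟩
  · have h₁ := hvi k (x k) (hmem k)
    have h₂ := P.objective_add (x k) (x (k + 1) - x k)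
    rw [add_sub_cancel] at h₂
    have h₃ := P.le_inner_mulQ_self (x (k + 1) - x k)
    have h₄ := mul_inner_le_half_mul_sq_add γ h.gamma_nonneg (x k - prevIterate x k)
      (x (k + 1) - x k)
    -- Here the gradient is taken at the new iterate. Returning to `x k` turns the second-order term
    -- `½⟨d, Qd⟩` of `f` into `-½⟨d, Qd⟩`, hence the lower bound by `λ_1`.
    have h₅ : P.mulQ (x (k + 1)) + P.q = (P.mulQ (x k) + P.q) + P.mulQ (x (k + 1) - x k) := by
      simp only [mulQ_eq_toEuclideanCLM, map_sub]
      abel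
    rw [← neg_sub (x (k + 1)) (x k), inner_neg_right, inner_sub_left, inner_sub_left, h₅,
      inner_add_left _ (P.mulQ (x (k + 1) - x k)), P.inner_mulQ_comm,
      real_inner_smul_left, real_inner_smul_left, real_inner_self_eq_norm_sq] at h₁
    linarith
  · convert hvi k using 1
    simp only [smul_apply, ContinuousLinearMap.id_apply, neg_smul]
    abel

/-! ### Vanishing steps and KKT cluster points -/

namespace IsInertialDescentSequence

variable {P : IQP n m} {γ σ : ℝ}
  {L : EuclideanSpace ℝ (Fin n) →L[ℝ] EuclideanSpace ℝ (Fin n)}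
  {x : ℕ → EuclideanSpace ℝ (Fin n)}

theorem exists_tendsto_energy (h : P.IsInertialDescentSequence γ σ L x)
    (hbdd : BddBelow (P.objective '' P.feasible)) :
    ∃ l, Tendsto (fun k => P.objective (x k) + γ / 2 * ‖x k - prevIterate x k‖ ^ 2) atTop (𝓝 l) := by
  refine ⟨_, tendsto_atTop_ciInf (antitone_nat_of_succ_le fun k => ?_) ?_⟩
  · have h₁ := h.descent k
    have h₂ := mul_nonneg h.sigma_pos.le (sq_nonneg ‖x (k + 1) - x k‖)
    change P.objective (x (k + 1)) + γ / 2 * ‖x (k + 1) - x k‖ ^ 2 ≤ _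
    linarith
  · obtain ⟨c, hc⟩ := hbdd
    refine ⟨c, ?_⟩
    rintro _ ⟨k, rfl⟩
    have h₁ := hc ⟨x k, h.mem k, rfl⟩
    have h₂ := mul_nonneg h.gamma_nonneg (sq_nonneg ‖x k - prevIterate x k‖)
    change c ≤ P.objective (x k) + γ / 2 * ‖x k - prevIterate x k‖ ^ 2
    linarith

theorem tendsto_step (h : P.IsInertialDescentSequence γ σ L x)
    (hbdd : BddBelow (P.objective '' P.feasible)) :
    Tendsto (fun k => x (k + 1) - x k) atTop (𝓝 0) := by
  obtain ⟨l, hl⟩ := h.exists_tendsto_energy hbdd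
  -- The energy drop between consecutive indices, divided by `σ`, dominates the squared step and
  -- tends to `0`.
  have hdiff := (hl.sub (hl.comp (tendsto_add_atTop_nat 1))).div_const σ
  rw [sub_self, zero_div] at hdiff
  have hsq : Tendsto (fun k => ‖x (k + 1) - x k‖ ^ 2) atTop (𝓝 0) := by
    refine squeeze_zero (fun k => sq_nonneg _) (fun k => ?_) hdiff
    rw [le_div_iff₀ h.sigma_pos]
    have h₁ := h.descent k
    change _ ≤ P.objective (x k) + γ / 2 * ‖x k - prevIterate x k‖ ^ 2
      - (P.objective (x (k + 1)) + γ / 2 * ‖x (k + 1) - x k‖ ^ 2)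
    linarith
  have := hsq.sqrt
  simp only [Real.sqrt_sq (norm_nonneg _), Real.sqrt_zero] at this
  exact tendsto_zero_iff_norm_tendsto_zero.2 this

theorem tendsto_sub_prevIterate (h : P.IsInertialDescentSequence γ σ L x)
    (hbdd : BddBelow (P.objective '' P.feasible)) :
    Tendsto (fun k => x k - prevIterate x k) atTop (𝓝 0) :=
  (tendsto_add_atTop_iff_nat 1).1 (h.tendsto_step hbdd)

theorem exists_tendsto_objective (h : P.IsInertialDescentSequence γ σ L x)
    (hbdd : BddBelow (P.objective '' P.feasible)) :
    ∃ l, Tendsto (fun k => P.objective (x k)) atTop (𝓝 l) := by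
  obtain ⟨l, hl⟩ := h.exists_tendsto_energy hbdd
  have h₁ := (((h.tendsto_sub_prevIterate hbdd).norm.pow 2).const_mul (γ / 2))
  refine ⟨_, (hl.sub h₁).congr fun k => ?_⟩
  ring

theorem tendsto_residual (h : P.IsInertialDescentSequence γ σ L x)
    (hbdd : BddBelow (P.objective '' P.feasible)) :
    Tendsto (fun k => L (x (k + 1) - x k) + γ • (x k - prevIterate x k)) atTop (𝓝 0) := by
  have h₁ := ((L.continuous.tendsto 0).comp (h.tendsto_step hbdd)).add
    ((h.tendsto_sub_prevIterate hbdd).const_smul γ)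
  simpa using h₁

theorem mem_kktSet_of_mapClusterPt (h : P.IsInertialDescentSequence γ σ L x)
    (hbdd : BddBelow (P.objective '' P.feasible)) {c : EuclideanSpace ℝ (Fin n)}
    (hc : MapClusterPt c atTop x) : c ∈ P.kktSet := by
  obtain ⟨U, hU, hUc⟩ := mapClusterPt_iff_ultrafilter.1 hc
  have hmem : c ∈ P.feasible :=
    P.isClosed_feasible.mem_of_tendsto hUc (Eventually.of_forall h.mem)
  have hsucc : Tendsto (fun k => x (k + 1)) U (𝓝 c) := by
    simpa using ((h.tendsto_step hbdd).mono_left hU).add hUc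
  refine P.mem_kktSet_of_neg_gradient_mem_normalCone hmem fun v hv => ?_
  have hlim := ((((h.tendsto_residual hbdd).mono_left hU).sub
    (((P.continuous_mulQ.tendsto c).comp hsucc).add_const P.q))).inner (𝕜 := ℝ)
      (hsucc.const_sub v)
  rw [zero_sub] at hlim
  -- With the test point `v` fixed, the normal-cone inequality passes to the limit.
  exact le_of_tendsto hlim (Eventually.of_forall fun k => h.normal k v hv)

end IsInertialDescentSequence

/-! ### Boundedness from the qualification condition -/

/-- A limit of directions `‖y‖⁻¹ y` of points of a pseudo-face that tend to infinity is a recession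
direction of the corresponding face. -/
theorem mem_recessionCone_face_of_tendsto (P : IQP n m) {ι : Type*} {l : Filter ι} [l.NeBot]
    {α : Finset (Fin m)} {y : ι → EuclideanSpace ℝ (Fin n)} {v : EuclideanSpace ℝ (Fin n)}
    (hy : ∀ᶠ k in l, y k ∈ P.pseudoFace α) (hinf : Tendsto (fun k => ‖y k‖) l atTop)
    (hv : Tendsto (fun k => ‖y k‖⁻¹ • y k) l (𝓝 v)) : v ∈ recessionCone (P.face α) := by
  have hA : ∀ i, Tendsto (fun k => ‖y k‖⁻¹ * P.A.mulVec (y k).ofLp i) l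
      (𝓝 (P.A.mulVec v.ofLp i)) := by
    intro i
    have hc : Continuous fun z : EuclideanSpace ℝ (Fin n) => P.A.mulVec z.ofLp i := by
      simp only [Matrix.mulVec, dotProduct]
      fun_prop
    refine ((hc.tendsto v).comp hv).congr fun k => ?_
    simp [Matrix.mulVec_smul]
  have hb : ∀ i, Tendsto (fun k => ‖y k‖⁻¹ * P.b i) l (𝓝 0) := by
    intro i
    simpa using (tendsto_inv_atTop_zero.comp hinf).mul_const (P.b i)
  have heq : ∀ i ∈ α, P.A.mulVec v.ofLp i = 0 := by
    intro i hi
    refine tendsto_nhds_unique (hA i) ((hb i).congr' ?_)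
    filter_upwards [hy] with k hk
    rw [hk.1 i hi]
  have hle : ∀ i ∉ α, 0 ≤ P.A.mulVec v.ofLp i := by
    intro i hi
    refine le_of_tendsto_of_tendsto (hb i) (hA i) ?_
    filter_upwards [hy] with k hk
    exact mul_le_mul_of_nonneg_left (hk.2 i hi).le (inv_nonneg.2 (norm_nonneg _))
  intro x hx t ht
  have hform : ∀ i, P.A.mulVec (x + t • v).ofLp i
      = P.A.mulVec x.ofLp i + t * P.A.mulVec v.ofLp i := by
    intro i
    simp [Matrix.mulVec_add, Matrix.mulVec_smul]
  refine ⟨fun i hi => ?_, fun i hi => ?_⟩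
  · rw [hform, heq i hi, mul_zero, add_zero, hx.1 i hi]
  · rw [hform]
    exact (hx.2 i hi).trans (le_add_of_nonneg_right (mul_nonneg ht (hle i hi)))

/-- Under the qualification condition, a sequence of feasible points that satisfy the optimality
condition up to residuals that tend to `0` is bounded. -/
theorem QualificationCondition.isBounded_range {P : IQP n m} (hQC : P.QualificationCondition)
    {y e : ℕ → EuclideanSpace ℝ (Fin n)} (hy : ∀ k, y k ∈ P.feasible)
    (he : Tendsto e atTop (𝓝 0))
    (hn : ∀ k, e k - (P.mulQ (y k) + P.q) ∈ normalCone P.feasible (y k)) :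
    Bornology.IsBounded (Set.range y) := by
  by_contra hunb
  have hne : (comap (fun k => ‖y k‖) atTop).NeBot := by
    refine comap_neBot fun s hs => ?_
    obtain ⟨R, hR⟩ := mem_atTop_sets.1 hs
    by_contra! hcon
    refine hunb (isBounded_iff_forall_norm_le.2 ⟨R, ?_⟩)
    rintro _ ⟨k, rfl⟩
    exact le_of_not_ge fun h => hcon k (hR _ h)
  have hU : (Ultrafilter.of (comap (fun k => ‖y k‖) atTop) : Filter ℕ)
    ≤ comap (fun k => ‖y k‖) atTop := Ultrafilter.of_le _
  generalize Ultrafilter.of (comap (fun k => ‖y k‖) atTop) = U at hU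
  have hinf : Tendsto (fun k => ‖y k‖) U atTop := tendsto_iff_comap.2 hU
  -- Norms tending to infinity along `U` rule out every single index, so `U` is free.
  have hUtop : (U : Filter ℕ) ≤ atTop := by
    rw [← Nat.cofinite_eq_atTop, le_cofinite_iff_compl_singleton_mem]
    intro k
    filter_upwards [hinf.eventually_gt_atTop ‖y k‖] with j hj hjk
    rw [Set.mem_singleton_iff.1 hjk] at hj
    exact lt_irrefl _ hj
  have hinv : Tendsto (fun k => ‖y k‖⁻¹) U (𝓝 0) := tendsto_inv_atTop_zero.comp hinf
  have hnorm : ∀ᶠ k in U, ‖y k‖⁻¹ • y k ∈ Metric.sphere (0 : EuclideanSpace ℝ (Fin n)) 1 := by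
    filter_upwards [hinf.eventually_gt_atTop 0] with k hk
    rw [mem_sphere_zero_iff_norm, norm_smul, norm_inv, norm_norm, inv_mul_cancel₀ hk.ne']
  obtain ⟨v, hv, hlim⟩ := (isCompact_sphere (0 : EuclideanSpace ℝ (Fin n)) 1).ultrafilter_le_nhds
    (U.map fun k => ‖y k‖⁻¹ • y k) (le_principal_iff.2 hnorm)
  replace hlim : Tendsto (fun k => ‖y k‖⁻¹ • y k) U (𝓝 v) := hlim
  -- Finitely many pseudo-faces cover `C`, so the ultrafilter selects one.
  obtain ⟨α, hα⟩ : ∃ α, ∀ᶠ k in U, y k ∈ P.pseudoFace α := by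
    have hcover : (⋃ α ∈ (Set.univ : Set (Finset (Fin m))), y ⁻¹' P.pseudoFace α) ∈ U :=
      mem_of_superset univ_mem fun k _ => by simpa using P.exists_mem_pseudoFace (hy k)
    obtain ⟨α, -, hα⟩ := (Ultrafilter.finite_biUnion_mem_iff Set.finite_univ).1 hcover
    exact ⟨α, hα⟩
  obtain ⟨k₀, hk₀⟩ := hα.exists
  have hunbα : ¬ Bornology.IsBounded (P.pseudoFace α) := by
    intro hb
    obtain ⟨R, hR⟩ := isBounded_iff_forall_norm_le.1 hb
    obtain ⟨k, hk, hkR⟩ := (hα.and (hinf.eventually_gt_atTop R)).exists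
    exact absurd (hR _ hk) (not_le.2 hkR)
  have hrec := P.mem_recessionCone_face_of_tendsto hα hinf hlim
  have hv0 : v ≠ 0 := norm_ne_zero_iff.1 (by
    rw [mem_sphere_zero_iff_norm.1 hv]
    exact one_ne_zero)
  -- After scaling, `e k` and `q` disappear. The normal cone is constant on the pseudo-face, so
  -- every inequality can be read at the fixed point `y k₀`.
  have hnormal : -P.mulQ v ∈ P.pseudoFaceNormalCone α := by
    refine ⟨y k₀, hk₀, fun w hw => ?_⟩
    have hvec : Tendsto (fun k => ‖y k‖⁻¹ • (e k - (P.mulQ (y k) + P.q))) U (𝓝 (-P.mulQ v)) := by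
      have h₁ := (hinv.smul (he.mono_left hUtop)).sub
        (((P.continuous_mulQ.tendsto v).comp hlim).add (hinv.smul_const P.q))
      simp only [smul_zero, zero_smul, add_zero, zero_sub] at h₁
      refine h₁.congr fun k => ?_
      simp [mulQ_eq_toEuclideanCLM, smul_sub, smul_add]
    refine le_of_tendsto (hvec.inner (𝕜 := ℝ) (tendsto_const_nhds (x := w - y k₀))) ?_
    filter_upwards [hα] with k hk
    rw [real_inner_smul_left]
    exact mul_nonpos_of_nonneg_of_nonpos (inv_nonneg.2 (norm_nonneg _))
      (P.normalCone_subset_of_mem_pseudoFace α hk hk₀ (hn k) w hw)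
  have hmem : P.mulQ v ∈ (P.mulQ '' (recessionCone (P.face α) \ {0}))
      ∩ {ξ | -ξ ∈ P.pseudoFaceNormalCone α} := ⟨⟨v, ⟨hrec, hv0⟩, rfl⟩, hnormal⟩
  rw [hQC α hunbα] at hmem
  exact hmem

theorem IsInertialDescentSequence.isBounded_range {P : IQP n m} {γ σ : ℝ}
    {L : EuclideanSpace ℝ (Fin n) →L[ℝ] EuclideanSpace ℝ (Fin n)}
    {x : ℕ → EuclideanSpace ℝ (Fin n)} (h : P.IsInertialDescentSequence γ σ L x)
    (hbdd : BddBelow (P.objective '' P.feasible)) (hQC : P.QualificationCondition) :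
    Bornology.IsBounded (Set.range x) := by
  -- The optimality condition holds only from `x 1` on; `x 0` is added by hand.
  have hb := hQC.isBounded_range (fun k => h.mem (k + 1)) (h.tendsto_residual hbdd) h.normal
  refine (hb.union (Bornology.isBounded_singleton (x := x 0))).subset ?_
  rintro _ ⟨_ | k, rfl⟩
  · exact Or.inr rfl
  · exact Or.inl ⟨k, rfl⟩

end IQP

/-! ### Conclusion -/

theorem theorem4p2 {n m : ℕ} (P : IQP n m)
    (hbdd : BddBelow (P.objective '' P.feasible))
    (hQC : P.QualificationCondition)
    (η γ : ℝ) (x : ℕ → EuclideanSpace ℝ (Fin n))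
    (hx : P.IsInDCA1Sequence η γ x ∨ P.IsInDCA2Sequence η γ x) :
    (∃ c ∈ P.kktSet, Filter.Tendsto
        (fun k => Metric.infDist (x k) (connectedComponentIn P.kktSet c))
        Filter.atTop (nhds 0)) ∧
      ∀ y z : EuclideanSpace ℝ (Fin n),
        MapClusterPt y Filter.atTop x → MapClusterPt z Filter.atTop x →
          P.objective y = P.objective z := by
  obtain ⟨σ, L, h⟩ : ∃ σ L, P.IsInertialDescentSequence γ σ L x :=
    hx.elim (fun h => ⟨_, _, h.isInertialDescentSequence⟩)
      (fun h => ⟨_, _, h.isInertialDescentSequence⟩)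
  have hb := h.isBounded_range hbdd hQC
  constructor
  · obtain ⟨c, -, hc⟩ := hb.isCompact_closure.exists_mapClusterPt (f := atTop) (u := x)
      (le_principal_iff.2 (mem_map.2 (Eventually.of_forall fun k => subset_closure ⟨k, rfl⟩)))
    have hsub : {y | MapClusterPt y atTop x} ⊆ P.kktSet := fun y hy =>
      h.mem_kktSet_of_mapClusterPt hbdd hy
    have hconn := isPreconnected_setOf_mapClusterPt hb (by
      simpa only [dist_eq_norm, norm_zero] using (h.tendsto_step hbdd).norm)
    -- The cluster set is connected, contains `c` and lies in `C_*`, so it stays in the component of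
    -- `c`.
    have hcomp := hconn.subset_connectedComponentIn hc hsub
    refine ⟨c, hsub hc, Metric.tendsto_atTop.2 fun ε hε => eventually_atTop.1 ?_⟩
    refine (eventually_mem_of_mapClusterPt_subset hb
      (Metric.isOpen_thickening (δ := ε) (E := connectedComponentIn P.kktSet c))
      fun y hy => Metric.self_subset_thickening hε _ (hcomp hy)).mono fun k hk => ?_
    rw [Real.dist_eq, sub_zero, abs_of_nonneg Metric.infDist_nonneg]
    exact (Metric.infDist_lt_iff ⟨c, mem_connectedComponentIn (hsub hc)⟩).2
      (Metric.mem_thickening_iff.1 hk)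
  · obtain ⟨l, hl⟩ := h.exists_tendsto_objective hbdd
    have key : ∀ y, MapClusterPt y atTop x → P.objective y = l := fun y hy => by
      obtain ⟨U, hU, hUy⟩ := mapClusterPt_iff_ultrafilter.1 hy
      exact tendsto_nhds_unique ((P.continuous_objective.tendsto y).comp hUy) (hl.mono_left hU)
    exact fun y z hy hz => (key y hy).trans (key z hz).symm
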